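/- Let $T$ be a finite metric tree: a finite tree each of whose edges $e$ is identified with a segment $[0,L_e]$, $0<L_e<\infty$. Let $V$ be a real-valued potential with $V\in L_2(e)$ for every edge $e$. To every vertex $v$ assign a coupling constant $\alpha_v\in\mathbb{R}\cup\{\infty\}$, with $\alpha_v\neq\infty$ whenever $v$ is internal, that is, of degree at least $2$. Let $\mathcal H$ be the operator in $L_2(T)=\bigoplus_e L_2(e)$ (complex-valued functions) that acts as $f\mapsto -f''+Vf$ on each edge. Its domain consists of all $f$ with $f\in H^2(e)$ for every edge $e$ that satisfy at every vertex $v$ the extended $\delta$-type condition: $f$ is continuous at $v$, and $$\sum_{e\ni v}\frac{df}{dx_e}(v)=\alpha_v f(v)\quad\text{if }\alpha_v\in\mathbb{R},\qquad f(v)=0\quad\text{if }\alpha_v=\infty,$$ where the sum runs over the edges incident to $v$ and the derivatives are taken away from the vertex and into the edge. (So there is a $\delta$-type condition at every internal vertex and an extended $\delta$-type condition at every vertex of degree $1$.) Let $\lambda$ be an eigenvalue of $\mathcal H$. 1. If $\lambda$ has an eigenfunction that is non-zero at all internal vertices of $T$, then $\lambda$ is simple, i.e. its eigenspace has dimension $1$.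 2. Equivalently, if $\lambda$ is multiple, i.e. its eigenspace has dimension greater than $1$, then there is an internal vertex $v$ of $T$ such that all functions from the eigenspace of $\lambda$ vanish at $v$. -/

import Mathlib

open MeasureTheory
open scoped ContDiff

noncomputable section

namespace QGraph

/-- The Hilbert space `L₂(0, ℓ)` of complex-valued functions. -/
abbrev L2Interval (ℓ : ℝ) : Type :=
  Lp ℂ 2 (volume.restrict (Set.Ioo (0 : ℝ) ℓ))

/-- `g ∈ L₂(0, ℓ)` is the weak derivative of `f ∈ L₂(0, ℓ)`, tested against smooth functions with
compact support in `(0, ℓ)`.  Hence `f ∈ H¹(0, ℓ)` iff `f` has a weak derivative in this sense, and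
`f ∈ H²(0, ℓ)` iff moreover its weak derivative has one. -/
def HasWeakDeriv {ℓ : ℝ} (f g : L2Interval ℓ) : Prop :=
  ∀ φ : ℝ → ℝ, ContDiff ℝ ∞ φ → HasCompactSupport φ → tsupport φ ⊆ Set.Ioo 0 ℓ →
    ∫ x in Set.Ioo 0 ℓ, ((deriv φ x : ℝ) : ℂ) * f x = -∫ x in Set.Ioo 0 ℓ, (φ x : ℂ) * g x

/-- `f` has a representative that is continuous on the closed interval `[0, ℓ]`, and its value at
the point `x ∈ [0, ℓ]` is `c`.  (Such a representative is unique on `[0, ℓ]`.) -/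
def HasTrace {ℓ : ℝ} (f : L2Interval ℓ) (x : ℝ) (c : ℂ) : Prop :=
  ∃ F : ℝ → ℂ, ContinuousOn F (Set.Icc 0 ℓ) ∧
    (f =ᵐ[volume.restrict (Set.Ioo 0 ℓ)] F) ∧ F x = c

lemma integrable_test_mul {ℓ : ℝ} {φ : ℝ → ℝ} (hφ : Continuous φ) (hc : HasCompactSupport φ)
    (f : L2Interval ℓ) :
    Integrable (fun x => (φ x : ℂ) * f x) (volume.restrict (Set.Ioo 0 ℓ)) := by
  have h1 : MemLp (fun x => (φ x : ℂ)) 2 (volume.restrict (Set.Ioo 0 ℓ)) :=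
    (Continuous.memLp_of_hasCompactSupport (by fun_prop)
      (hc.comp_left (g := fun r : ℝ => (r : ℂ)) (by simp))).restrict _
  exact h1.integrable_mul (Lp.memLp f)

lemma HasWeakDeriv.linear {ℓ : ℝ} {f g f' g' : L2Interval ℓ} (a b : ℂ)
    (hf : HasWeakDeriv f f') (hg : HasWeakDeriv g g') :
    HasWeakDeriv (a • f + b • g) (a • f' + b • g') := by
  intro φ h1 h2 h3
  have hd : Continuous (deriv φ) := h1.continuous_deriv (by simp)
  have key : ∀ (ψ : ℝ → ℝ), Continuous ψ → HasCompactSupport ψ → ∀ u w : L2Interval ℓ,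
      ∫ x in Set.Ioo 0 ℓ, (ψ x : ℂ) * (a • u + b • w : L2Interval ℓ) x =
        a * (∫ x in Set.Ioo 0 ℓ, (ψ x : ℂ) * u x) +
          b * ∫ x in Set.Ioo 0 ℓ, (ψ x : ℂ) * w x := by
    intro ψ c1 c2 u w
    rw [← integral_const_mul, ← integral_const_mul, ← integral_add
      ((integrable_test_mul c1 c2 u).const_mul a) ((integrable_test_mul c1 c2 w).const_mul b)]
    apply integral_congr_ae
    filter_upwards [Lp.coeFn_add (a • u) (b • w), Lp.coeFn_smul a u, Lp.coeFn_smul b w]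
      with x e1 e2 e3
    simp only [e1, e2, e3, Pi.add_apply, Pi.smul_apply, smul_eq_mul]
    ring
  rw [key _ hd h2.deriv, key _ h1.continuous h2, hf φ h1 h2 h3, hg φ h1 h2 h3]
  ring

lemma HasTrace.linear {ℓ : ℝ} {f g : L2Interval ℓ} {x : ℝ} {c d : ℂ} (a b : ℂ)
    (hf : HasTrace f x c) (hg : HasTrace g x d) : HasTrace (a • f + b • g) x (a * c + b * d) := by
  obtain ⟨F, F1, F2, F3⟩ := hf
  obtain ⟨H, H1, H2, H3⟩ := hg
  refine ⟨fun y => a * F y + b * H y, by fun_prop, ?_, by simp [F3, H3]⟩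
  filter_upwards [Lp.coeFn_add (a • f) (b • g), Lp.coeFn_smul a f, Lp.coeFn_smul b g, F2, H2]
    with y e1 e2 e3 e4 e5
  simp only [e1, e2, e3, e4, e5, Pi.add_apply, Pi.smul_apply, smul_eq_mul]

lemma HasWeakDeriv.zero {ℓ : ℝ} : HasWeakDeriv (0 : L2Interval ℓ) 0 := by
  intro φ _ _ _
  have h : ∀ ψ : ℝ → ℝ, ∫ x in Set.Ioo 0 ℓ, (ψ x : ℂ) * (0 : L2Interval ℓ) x = 0 := by
    intro ψ
    apply integral_eq_zero_of_ae
    filter_upwards [Lp.coeFn_zero ℂ 2 (volume.restrict (Set.Ioo (0 : ℝ) ℓ))] with x hx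
    simp only [hx, Pi.zero_apply, mul_zero]
  rw [h, h, neg_zero]

lemma HasTrace.zero {ℓ x : ℝ} : HasTrace (0 : L2Interval ℓ) x 0 :=
  ⟨0, continuousOn_const, Lp.coeFn_zero _ _ _, rfl⟩

/-- A finite metric graph on the combinatorial graph `G`, with a Schrödinger potential and coupling
constants of extended `δ`-type vertex conditions.  The edge `e` is the segment `[0, length e]`, with
a coordinate that runs from the end vertex `src e` to the end vertex `tgt e`. -/
structure QuantumGraph {V : Type*} (G : SimpleGraph V) where
  /-- edge lengths, positive and finite -/
  length : G.edgeSet → ℝ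
  length_pos : ∀ e, 0 < length e
  /-- the end vertex at coordinate `0` -/
  src : G.edgeSet → V
  /-- the end vertex at coordinate `length e` -/
  tgt : G.edgeSet → V
  ends : ∀ e, s(src e, tgt e) = (e : Sym2 V)
  /-- the real electric potential, square integrable on each edge -/
  potential : G.edgeSet → ℝ → ℝ
  potential_memLp : ∀ e, MemLp (potential e) 2 (volume.restrict (Set.Ioo 0 (length e)))
  /-- the coupling constants; the value `⊤` stands for the vertex Dirichlet condition -/
  coupling : V → WithTop ℝ

namespace QuantumGraph

variable {V : Type*} [Fintype V] [DecidableEq V] {G : SimpleGraph V} [DecidableRel G.Adj]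

/-- `L₂(Γ)`, the orthogonal direct sum of the spaces `L₂(e)`. -/
abbrev L2 (Γ : QuantumGraph G) : Type _ :=
  PiLp 2 (fun e : G.edgeSet => L2Interval (Γ.length e))

/-- `f` is continuous at the vertex `v`, with `f(v) = c`: along every edge incident to `v` the
function `f` attains at `v` the value `c`. -/
def HasValue (Γ : QuantumGraph G) (f : Γ.L2) (v : V) (c : ℂ) : Prop :=
  ∀ e, (Γ.src e = v → HasTrace (f e) 0 c) ∧ (Γ.tgt e = v → HasTrace (f e) (Γ.length e) c)

/-- If `f'` is the edgewise derivative of `f`, then `s` is the sum, over the edges incident to `v`,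
of the derivatives of `f` at `v` taken away from the vertex and into the edge. -/
def HasFlux (Γ : QuantumGraph G) (f' : Γ.L2) (v : V) (s : ℂ) : Prop :=
  ∃ a b : G.edgeSet → ℂ,
    (∀ e, HasTrace (f' e) 0 (a e)) ∧ (∀ e, HasTrace (f' e) (Γ.length e) (b e)) ∧
    s = ∑ e with Γ.src e = v, a e - ∑ e with Γ.tgt e = v, b e

/-- The extended `δ`-type condition at `v`: `f` is continuous at `v`, and the sum of the outgoing
derivatives is `α f(v)` if the coupling constant `α` is finite, while `f(v) = 0` if it is infinite.
Here `f'` is the edgewise derivative of `f`. -/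
def DeltaCondition (Γ : QuantumGraph G) (f f' : Γ.L2) (v : V) : Prop :=
  ∃ c : ℂ, Γ.HasValue f v c ∧ (Γ.coupling v = ⊤ → c = 0) ∧
    ∀ α : ℝ, Γ.coupling v = (α : WithTop ℝ) → Γ.HasFlux f' v (α * c)

/-- The Hamiltonian: `f` belongs to its domain and is mapped to `h`.  That is, `f` is in `H²(e)` for
every edge `e`, it satisfies the vertex conditions, and `h = -f'' + V f`. -/
def HamiltonianMapsTo (Γ : QuantumGraph G) (f h : Γ.L2) : Prop :=
  ∃ f' f'' : Γ.L2,
    (∀ e, HasWeakDeriv (f e) (f' e)) ∧ (∀ e, HasWeakDeriv (f' e) (f'' e)) ∧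
    (∀ v, Γ.DeltaCondition f f' v) ∧
    ∀ e, ∀ᵐ x ∂(volume.restrict (Set.Ioo 0 (Γ.length e))),
      h e x = -(f'' e x) + (Γ.potential e x : ℂ) * f e x

lemma HamiltonianMapsTo.linear {Γ : QuantumGraph G} {f g h k : Γ.L2} (a b : ℂ)
    (hf : Γ.HamiltonianMapsTo f h) (hg : Γ.HamiltonianMapsTo g k) :
    Γ.HamiltonianMapsTo (a • f + b • g) (a • h + b • k) := by
  obtain ⟨f', f'', f1, f2, f3, f4⟩ := hf
  obtain ⟨g', g'', g1, g2, g3, g4⟩ := hg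
  refine ⟨a • f' + b • g', a • f'' + b • g'', fun e => (f1 e).linear a b (g1 e),
    fun e => (f2 e).linear a b (g2 e), fun v => ?_, fun e => ?_⟩
  · obtain ⟨c, c1, c2, c3⟩ := f3 v
    obtain ⟨d, d1, d2, d3⟩ := g3 v
    refine ⟨a * c + b * d, fun e => ⟨fun he => ((c1 e).1 he).linear a b ((d1 e).1 he),
      fun he => ((c1 e).2 he).linear a b ((d1 e).2 he)⟩,
      fun ht => by rw [c2 ht, d2 ht]; simp, fun α hα => ?_⟩
    obtain ⟨p, q, p1, q1, s1⟩ := c3 α hα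
    obtain ⟨r, t, r1, t1, s2⟩ := d3 α hα
    refine ⟨fun e => a * p e + b * r e, fun e => a * q e + b * t e,
      fun e => (p1 e).linear a b (r1 e), fun e => (q1 e).linear a b (t1 e), ?_⟩
    simp only [Finset.sum_add_distrib, ← Finset.mul_sum]
    linear_combination a * s1 + b * s2
  · filter_upwards [f4 e, g4 e,
      Lp.coeFn_add (a • f e) (b • g e), Lp.coeFn_smul a (f e), Lp.coeFn_smul b (g e),
      Lp.coeFn_add (a • h e) (b • k e), Lp.coeFn_smul a (h e), Lp.coeFn_smul b (k e),
      Lp.coeFn_add (a • f'' e) (b • g'' e), Lp.coeFn_smul a (f'' e), Lp.coeFn_smul b (g'' e)]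
      with x e1 e2 e3 e4 e5 e6 e7 e8 e9 e10 e11
    simp only [PiLp.add_apply, PiLp.smul_apply, e1, e2, e3, e4, e5, e6, e7, e8, e9, e10, e11,
      Pi.add_apply, Pi.smul_apply, smul_eq_mul]
    ring

lemma HamiltonianMapsTo.zero {Γ : QuantumGraph G} : Γ.HamiltonianMapsTo 0 0 := by
  refine ⟨0, 0, fun _ => HasWeakDeriv.zero, fun _ => HasWeakDeriv.zero,
    fun v => ⟨0, fun e => ⟨fun _ => HasTrace.zero, fun _ => HasTrace.zero⟩, fun _ => rfl,
      fun α _ => ⟨0, 0, fun _ => HasTrace.zero, fun _ => HasTrace.zero, by simp⟩⟩, fun e => ?_⟩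
  filter_upwards [Lp.coeFn_zero ℂ 2 (volume.restrict (Set.Ioo (0 : ℝ) (Γ.length e)))] with x hx
  simp only [PiLp.zero_apply, hx, Pi.zero_apply, mul_zero, neg_zero, add_zero]

/-- The eigenspace of the Hamiltonian for the value `μ`: all `f` in its domain with `H f = μ f`. -/
def eigenspace (Γ : QuantumGraph G) (μ : ℂ) : Submodule ℂ Γ.L2 where
  carrier := {f | Γ.HamiltonianMapsTo f (μ • f)}
  zero_mem' := by
    simpa using HamiltonianMapsTo.zero (Γ := Γ)
  add_mem' := by
    intro f g hf hg
    simpa [smul_add] using HamiltonianMapsTo.linear 1 1 hf hg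
  smul_mem' := by
    intro c f hf
    simpa [smul_comm c μ] using HamiltonianMapsTo.linear c 0 hf hf

/-- An internal vertex of a tree is a vertex of degree at least `2`. -/
def IsInternal (_Γ : QuantumGraph G) (v : V) : Prop := 2 ≤ G.degree v

end QuantumGraph

end QGraph

end

/-! The proof is a Wronskian argument. For two functions `f`, `g` in the eigenspace, the Wronskian
`f g' - f' g` (without conjugation) is constant on each edge. The vertex conditions make its signed
sum around each vertex zero, so it is a conserved flow on the edges. Every edge of a tree is a
bridge, hence the flow vanishes (`flow_eq_zero`, `wronskian_eq_zero`).

Now let `f` be non-zero at internal vertices. On an edge where `f` is not identically zero, the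
vanishing Wronskian makes the Cauchy data of `g` a multiple `k` of those of `f`, so `h = g - k f`
vanishes there. If `h` vanishes on one edge at an internal vertex `v`, then `h(v) = 0`, and the
Wronskian of `f` and `h` gives `f(v) h'(v) = 0` along every other edge at `v`. Uniqueness for the
Cauchy problem kills `h` on those edges, and connectedness spreads this to the whole tree
(`IsEigenData.eq_zero`, `exists_eq_smul`). The second claim follows because a complex vector space
is not a finite union of proper subspaces.

The potential is only integrable on edges, so the differential equation is used in integrated form.
Weak derivatives are turned into primitives by the du Bois-Reymond lemma. -/

/-! ### Integration by parts for absolutely continuous functions -/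

open Set Filter Topology AbsolutelyContinuousOnInterval in
/-- The primitive of a complex integrable function is absolutely continuous. -/
lemma absolutelyContinuousOnInterval_integral_complex {p : ℝ → ℂ} {a b : ℝ}
    (hp : IntervalIntegrable p volume a b) :
    AbsolutelyContinuousOnInterval (fun x => ∫ t in a..x, p t) a b := by
  have h := hp.norm.absolutelyContinuousOnInterval_intervalIntegral (c := a) left_mem_uIcc
  -- The increments of the primitive of `p` are dominated by those of the primitive of `‖p‖`, for
  -- which the real-valued result is available.
  refine squeeze_zero' (Eventually.of_forall fun E => Finset.sum_nonneg fun i _ => dist_nonneg) ?_ h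
  rw [eventually_inf_principal]
  filter_upwards with E hE
  refine Finset.sum_le_sum fun i hi => ?_
  obtain ⟨h1, h2⟩ := hE.1 i hi
  have m1 : IntervalIntegrable p volume a (E.2 i).1 := hp.mono_set (uIcc_subset_uIcc_left h1)
  have m2 : IntervalIntegrable p volume a (E.2 i).2 := hp.mono_set (uIcc_subset_uIcc_left h2)
  rw [dist_eq_norm, Real.dist_eq, intervalIntegral.integral_interval_sub_left m1 m2,
    intervalIntegral.integral_interval_sub_left m1.norm m2.norm]
  exact intervalIntegral.norm_integral_le_abs_integral_norm

/-- Integration by parts for primitives of complex integrable functions. -/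
lemma intervalIntegral_mul_add_mul_of_primitive {p q F G : ℝ → ℂ} {a b : ℝ}
    (hp : IntervalIntegrable p volume a b) (hq : IntervalIntegrable q volume a b)
    (hF : ∀ x ∈ Set.uIcc a b, F x = F a + ∫ t in a..x, p t)
    (hG : ∀ x ∈ Set.uIcc a b, G x = G a + ∫ t in a..x, q t) :
    ∫ t in a..b, (p t * G t + F t * q t) = F b * G b - F a * G a := by
  have hconst : ∀ c : ℂ, AbsolutelyContinuousOnInterval (fun _ : ℝ => c) a b := fun c =>
    (contDiff_const (n := 1)).contDiffOn.absolutelyContinuousOnInterval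
  set A : ℝ → ℂ := fun x => F a + ∫ t in a..x, p t with hA
  set B : ℝ → ℂ := fun x => G a + ∫ t in a..x, q t with hB
  have acA : AbsolutelyContinuousOnInterval A a b :=
    (hconst (F a)).add (absolutelyContinuousOnInterval_integral_complex hp)
  have acB : AbsolutelyContinuousOnInterval B a b :=
    (hconst (G a)).add (absolutelyContinuousOnInterval_integral_complex hq)
  have hr : IntervalIntegrable (fun t => p t * B t + A t * q t) volume a b :=
    (hp.mul_continuousOn acB.continuousOn).add (hq.continuousOn_mul acA.continuousOn)
  have acD := (acA.smul acB).sub (absolutelyContinuousOnInterval_integral_complex hr)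
  -- `A * B` minus the primitive of `p * B + A * q` is absolutely continuous with derivative zero
  -- almost everywhere, so its values at `a` and `b` agree.
  obtain ⟨C, hC⟩ := acD.const_of_ae_hasDerivAt_zero (by
    filter_upwards [hp.ae_hasDerivAt_integral, hq.ae_hasDerivAt_integral,
      hr.ae_hasDerivAt_integral] with x h1 h2 h3 hx
    have d := (((h1 hx a Set.left_mem_uIcc).const_add (F a)).mul
      ((h2 hx a Set.left_mem_uIcc).const_add (G a))).sub (h3 hx a Set.left_mem_uIcc)
    rw [sub_self] at d
    exact d)
  have e1 := hC a Set.left_mem_uIcc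
  have e2 := hC b Set.right_mem_uIcc
  rw [← e1] at e2
  simp only [Pi.sub_apply, smul_eq_mul, Pi.mul_apply, intervalIntegral.integral_same,
    sub_zero] at e2
  rw [hF b Set.right_mem_uIcc, hG b Set.right_mem_uIcc]
  have e3 : ∫ t in a..b, (p t * G t + F t * q t) = ∫ t in a..b, (p t * B t + A t * q t) := by
    refine intervalIntegral.integral_congr fun t ht => ?_
    simp only [hF t ht, hG t ht, hA, hB]
  have e4 : A a = F a := by simp [hA]
  have e5 : B a = G a := by simp [hB]
  rw [e3]
  rw [e4, e5] at e2
  linear_combination -e2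

/-! ### The equation `F'' = q F` with integrable `q` -/

namespace QGraph

/-- `F` is a solution of `F'' = q F` on `[0, ℓ]` with derivative `P`, in integrated form. -/
structure IsSolution (q : ℝ → ℂ) (ℓ : ℝ) (F P : ℝ → ℂ) : Prop where
  cont : ContinuousOn F (Set.Icc 0 ℓ)
  cont' : ContinuousOn P (Set.Icc 0 ℓ)
  eq : ∀ x ∈ Set.Icc 0 ℓ, F x = F 0 + ∫ t in (0 : ℝ)..x, P t
  eq' : ∀ x ∈ Set.Icc 0 ℓ, P x = P 0 + ∫ t in (0 : ℝ)..x, q t * F t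

namespace IsSolution

variable {q F P G Q : ℝ → ℂ} {ℓ : ℝ}

lemma intervalIntegrable_of_mem {p : ℝ → ℂ} (hp : IntervalIntegrable p volume 0 ℓ) {x y : ℝ}
    (hx : x ∈ Set.Icc 0 ℓ) (hy : y ∈ Set.Icc 0 ℓ) : IntervalIntegrable p volume x y := by
  have h0 : (0 : ℝ) ≤ ℓ := hx.1.trans hx.2
  refine hp.mono_set ?_
  rw [Set.uIcc_of_le h0]
  exact Set.OrdConnected.uIcc_subset Set.ordConnected_Icc hx hy

lemma intervalIntegrable (h : IsSolution q ℓ F P) (h0 : 0 ≤ ℓ) :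
    IntervalIntegrable P volume 0 ℓ :=
  ContinuousOn.intervalIntegrable (by rw [Set.uIcc_of_le h0]; exact h.cont')

lemma intervalIntegrable' (h : IsSolution q ℓ F P) (h0 : 0 ≤ ℓ)
    (hq : IntervalIntegrable q volume 0 ℓ) :
    IntervalIntegrable (fun t => q t * F t) volume 0 ℓ :=
  hq.mul_continuousOn (by rw [Set.uIcc_of_le h0]; exact h.cont)

/-- The Wronskian of two solutions is constant. -/
lemma wronskian (hF : IsSolution q ℓ F P) (hG : IsSolution q ℓ G Q)
    (hq : IntervalIntegrable q volume 0 ℓ) {x : ℝ} (hx : x ∈ Set.Icc 0 ℓ) :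
    F x * Q x - P x * G x = F 0 * Q 0 - P 0 * G 0 := by
  have h0 : (0 : ℝ) ≤ ℓ := hx.1.trans hx.2
  have m0 : (0 : ℝ) ∈ Set.Icc 0 ℓ := ⟨le_rfl, h0⟩
  have sub : ∀ y ∈ Set.uIcc 0 x, y ∈ Set.Icc 0 ℓ := fun y hy =>
    Set.OrdConnected.uIcc_subset Set.ordConnected_Icc m0 hx hy
  have i1 := intervalIntegrable_of_mem (hF.intervalIntegrable h0) m0 hx
  have i2 := intervalIntegrable_of_mem (hF.intervalIntegrable' h0 hq) m0 hx
  have i3 := intervalIntegrable_of_mem (hG.intervalIntegrable h0) m0 hx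
  have i4 := intervalIntegrable_of_mem (hG.intervalIntegrable' h0 hq) m0 hx
  -- `F * Q` and `P * G` are primitives of the same function `P * Q + q * F * G`.
  have e1 := intervalIntegral_mul_add_mul_of_primitive i1 i4 (fun y hy => hF.eq y (sub y hy))
    (fun y hy => hG.eq' y (sub y hy))
  have e2 := intervalIntegral_mul_add_mul_of_primitive i2 i3 (fun y hy => hF.eq' y (sub y hy))
    (fun y hy => hG.eq y (sub y hy))
  have e3 : ∫ t in (0 : ℝ)..x, (P t * Q t + F t * (q t * G t)) =
      ∫ t in (0 : ℝ)..x, (q t * F t * G t + P t * Q t) :=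
    intervalIntegral.integral_congr fun t _ => by ring
  rw [e3, e2] at e1
  linear_combination -e1

lemma sub_smul (hG : IsSolution q ℓ G Q) (hF : IsSolution q ℓ F P)
    (hq : IntervalIntegrable q volume 0 ℓ) (k : ℂ) :
    IsSolution q ℓ (fun x => G x - k * F x) (fun x => Q x - k * P x) := by
  refine ⟨hG.cont.sub (hF.cont.const_mul k), hG.cont'.sub (hF.cont'.const_mul k),
    fun x hx => ?_, fun x hx => ?_⟩
  all_goals
    have h0 : (0 : ℝ) ≤ ℓ := hx.1.trans hx.2
    have m0 : (0 : ℝ) ∈ Set.Icc 0 ℓ := ⟨le_rfl, h0⟩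
  · rw [intervalIntegral.integral_sub (intervalIntegrable_of_mem (hG.intervalIntegrable h0) m0 hx)
      ((intervalIntegrable_of_mem (hF.intervalIntegrable h0) m0 hx).const_mul k),
      intervalIntegral.integral_const_mul, hG.eq x hx, hF.eq x hx]
    ring
  · have e : ∫ t in (0 : ℝ)..x, q t * (G t - k * F t) =
        ∫ t in (0 : ℝ)..x, (q t * G t - k * (q t * F t)) :=
      intervalIntegral.integral_congr fun t _ => by ring
    rw [e, intervalIntegral.integral_sub
      (intervalIntegrable_of_mem (hG.intervalIntegrable' h0 hq) m0 hx)
      ((intervalIntegrable_of_mem (hF.intervalIntegrable' h0 hq) m0 hx).const_mul k),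
      intervalIntegral.integral_const_mul, hG.eq' x hx, hF.eq' x hx]
    ring

/-- The growth estimate behind local uniqueness. -/
lemma norm_add_norm_le (h : IsSolution q ℓ F P) (hq : IntervalIntegrable q volume 0 ℓ)
    {x y M : ℝ} (hx : x ∈ Set.Icc 0 ℓ) (hy : y ∈ Set.Icc 0 ℓ) (hF : F x = 0) (hP : P x = 0)
    (hM : ∀ t ∈ Set.uIcc x y, ‖F t‖ + ‖P t‖ ≤ M) :
    ‖F y‖ + ‖P y‖ ≤ M * |∫ t in x..y, (1 + ‖q t‖)| := by
  have h0 : (0 : ℝ) ≤ ℓ := hx.1.trans hx.2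
  have m0 : (0 : ℝ) ∈ Set.Icc 0 ℓ := ⟨le_rfl, h0⟩
  have iP := h.intervalIntegrable h0
  have iF := h.intervalIntegrable' h0 hq
  have eF : F y = ∫ t in x..y, P t := by
    rw [← intervalIntegral.integral_interval_sub_left (intervalIntegrable_of_mem iP m0 hy)
      (intervalIntegrable_of_mem iP m0 hx)]
    linear_combination h.eq y hy - h.eq x hx + hF
  have eP : P y = ∫ t in x..y, q t * F t := by
    rw [← intervalIntegral.integral_interval_sub_left (intervalIntegrable_of_mem iF m0 hy)
      (intervalIntegrable_of_mem iF m0 hx)]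
    linear_combination h.eq' y hy - h.eq' x hx + hP
  have jP := (intervalIntegrable_of_mem iP hx hy).norm
  have jF := (intervalIntegrable_of_mem iF hx hy).norm
  have jq := (intervalIntegrable_of_mem hq hx hy).norm
  have jK : IntervalIntegrable (fun t => 1 + ‖q t‖) volume x y :=
    intervalIntegrable_const.add jq
  have pt : ∀ t ∈ Set.uIcc x y, ‖P t‖ + ‖q t * F t‖ ≤ M * (1 + ‖q t‖) := by
    intro t ht
    have h1 := hM t ht
    have h2 : ‖q t‖ * ‖F t‖ ≤ ‖q t‖ * M :=
      mul_le_mul_of_nonneg_left (by linarith [norm_nonneg (P t)]) (norm_nonneg _)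
    rw [norm_mul]
    linarith [norm_nonneg (F t)]
  rw [eF, eP]
  rcases le_total x y with hxy | hxy
  · rw [abs_of_nonneg (intervalIntegral.integral_nonneg hxy fun t _ => by positivity),
      ← intervalIntegral.integral_const_mul]
    calc _ ≤ (∫ t in x..y, ‖P t‖) + ∫ t in x..y, ‖q t * F t‖ :=
          add_le_add (intervalIntegral.norm_integral_le_integral_norm hxy)
            (intervalIntegral.norm_integral_le_integral_norm hxy)
      _ = ∫ t in x..y, (‖P t‖ + ‖q t * F t‖) := (intervalIntegral.integral_add jP jF).symm
      _ ≤ _ := intervalIntegral.integral_mono_on hxy (jP.add jF) (jK.const_mul M)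
          fun t ht => pt t (by rwa [Set.uIcc_of_le hxy])
  · rw [intervalIntegral.integral_symm y x, intervalIntegral.integral_symm y x,
      intervalIntegral.integral_symm y x, norm_neg, norm_neg, abs_neg,
      abs_of_nonneg (intervalIntegral.integral_nonneg hxy fun t _ => by positivity),
      ← intervalIntegral.integral_const_mul]
    calc _ ≤ (∫ t in y..x, ‖P t‖) + ∫ t in y..x, ‖q t * F t‖ :=
          add_le_add (intervalIntegral.norm_integral_le_integral_norm hxy)
            (intervalIntegral.norm_integral_le_integral_norm hxy)
      _ = ∫ t in y..x, (‖P t‖ + ‖q t * F t‖) :=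
          (intervalIntegral.integral_add jP.symm jF.symm).symm
      _ ≤ _ := intervalIntegral.integral_mono_on hxy (jP.symm.add jF.symm) (jK.symm.const_mul M)
          fun t ht => pt t (by rwa [Set.uIcc_of_ge hxy])

/-- A solution with vanishing Cauchy data at one point vanishes identically. -/
lemma eq_zero (h : IsSolution q ℓ F P) (hq : IntervalIntegrable q volume 0 ℓ)
    {x : ℝ} (hx : x ∈ Set.Icc 0 ℓ) (hF : F x = 0) (hP : P x = 0) :
    ∀ y ∈ Set.Icc 0 ℓ, F y = 0 ∧ P y = 0 := by
  have h0 : (0 : ℝ) ≤ ℓ := hx.1.trans hx.2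
  have m0 : (0 : ℝ) ∈ Set.Icc 0 ℓ := ⟨le_rfl, h0⟩
  have iK : IntervalIntegrable (fun t => 1 + ‖q t‖) volume 0 ℓ :=
    intervalIntegrable_const.add hq.norm
  have mem : ∀ {u v : ℝ}, u ∈ Set.Icc 0 ℓ → v ∈ Set.Icc 0 ℓ →
      IntervalIntegrable (fun t => 1 + ‖q t‖) volume u v := fun hu hv =>
    iK.mono_set (by
      rw [Set.uIcc_of_le h0]
      exact Set.OrdConnected.uIcc_subset Set.ordConnected_Icc hu hv)
  have hcont : ContinuousOn (fun y => ∫ t in (0 : ℝ)..y, (1 + ‖q t‖)) (Set.Icc 0 ℓ) := by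
    have := intervalIntegral.continuousOn_primitive_interval'
      (f := fun t => 1 + ‖q t‖) (μ := volume) (b₁ := 0) (b₂ := ℓ) (a := 0) iK Set.left_mem_uIcc
    rwa [Set.uIcc_of_le h0] at this
  -- Vanishing at a point implies vanishing at all nearby points.
  have hloc : ∀ z ∈ Set.Icc 0 ℓ, F z = 0 → P z = 0 →
      ∃ δ > 0, ∀ y ∈ Set.Icc 0 ℓ, |y - z| < δ → F y = 0 ∧ P y = 0 := by
    intro z hz hz1 hz2
    obtain ⟨δ, hδ, hd⟩ := Metric.continuousOn_iff.1 hcont z hz (1 / 2) (by norm_num)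
    refine ⟨δ, hδ, fun y hy hyz => ?_⟩
    have hsub : Set.uIcc z y ⊆ Set.Icc 0 ℓ :=
      Set.OrdConnected.uIcc_subset Set.ordConnected_Icc hz hy
    -- At a maximum point `w` of `‖F‖ + ‖P‖` between `z` and `y`, the growth estimate bounds the
    -- maximum by at most half of itself, so it is zero.
    obtain ⟨w, hw, hmax⟩ := (isCompact_uIcc (a := z) (b := y)).exists_isMaxOn
      ⟨z, Set.left_mem_uIcc⟩ ((h.cont.mono hsub).norm.add (h.cont'.mono hsub).norm)
    have hwI := hsub hw
    have hwz : |w - z| < δ := (Set.abs_sub_left_of_mem_uIcc hw).trans_lt hyz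
    have hbd := h.norm_add_norm_le hq hz hwI hz1 hz2 (M := ‖F w‖ + ‖P w‖)
      (fun t ht => hmax (Set.uIcc_subset_uIcc_left hw ht))
    have hsmall : |∫ t in z..w, (1 + ‖q t‖)| < 1 / 2 := by
      have := hd w hwI (by rwa [Real.dist_eq])
      rwa [Real.dist_eq, intervalIntegral.integral_interval_sub_left (mem m0 hwI) (mem m0 hz)]
        at this
    have hle : ‖F y‖ + ‖P y‖ ≤ ‖F w‖ + ‖P w‖ := hmax (Set.right_mem_uIcc (a := z) (b := y))
    have n1 := norm_nonneg (F y)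
    have n2 := norm_nonneg (P y)
    have hzero : ‖F w‖ + ‖P w‖ ≤ 0 := by
      nlinarith [norm_nonneg (F w), norm_nonneg (P w)]
    exact ⟨norm_le_zero_iff.1 (by linarith), norm_le_zero_iff.1 (by linarith)⟩
  have : PreconnectedSpace (Set.Icc (0 : ℝ) ℓ) := Subtype.preconnectedSpace isPreconnected_Icc
  -- The set where both components vanish is closed by continuity and open by `hloc`, so in a
  -- connected interval it is everything.
  have hclopen : IsClopen {y : Set.Icc (0 : ℝ) ℓ | F y = 0 ∧ P y = 0} := by
    refine ⟨(isClosed_eq h.cont.domRestrict continuous_const).inter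
      (isClosed_eq h.cont'.domRestrict continuous_const), Metric.isOpen_iff.2 ?_⟩
    rintro z ⟨hz1, hz2⟩
    obtain ⟨δ, hδ, hd⟩ := hloc z z.2 hz1 hz2
    exact ⟨δ, hδ, fun y hy => hd y y.2 hy⟩
  have huniv := hclopen.eq_univ ⟨⟨x, hx⟩, hF, hP⟩
  exact fun y hy => huniv.symm.subset (Set.mem_univ (⟨y, hy⟩ : Set.Icc (0 : ℝ) ℓ))

end IsSolution

end QGraph

/-! ### The du Bois-Reymond lemma -/

lemma IsCompact.exists_subset_Icc_of_subset_Ioo {K : Set ℝ} {a b : ℝ} (hK : IsCompact K)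
    (hab : a < b) (h : K ⊆ Set.Ioo a b) : ∃ c d, a < c ∧ d < b ∧ K ⊆ Set.Icc c d := by
  rcases K.eq_empty_or_nonempty with rfl | hne
  · exact ⟨b, a, hab, hab, Set.empty_subset _⟩
  · obtain ⟨c, hc⟩ := hK.exists_isLeast hne
    obtain ⟨d, hd⟩ := hK.exists_isGreatest hne
    exact ⟨c, d, (h hc.1).1, (h hd.1).2, fun x hx => ⟨hc.2 hx, hd.2 hx⟩⟩

lemma setIntegral_Ioo_eq_intervalIntegral {E : Type*} [NormedAddCommGroup E] [NormedSpace ℝ E]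
    {f : ℝ → E} {a b : ℝ} (hab : a ≤ b) : ∫ x in Set.Ioo a b, f x = ∫ x in a..b, f x := by
  rw [intervalIntegral.integral_of_le hab, integral_Ioc_eq_integral_Ioo]

/-- A test function of mean zero is the derivative of a test function. -/
lemma exists_deriv_eq_of_integral_eq_zero {ψ : ℝ → ℝ} {ℓ : ℝ} (hℓ : 0 < ℓ)
    (h1 : ContDiff ℝ ∞ ψ) (h2 : HasCompactSupport ψ) (h3 : tsupport ψ ⊆ Set.Ioo 0 ℓ)
    (h4 : ∫ x in Set.Ioo 0 ℓ, ψ x = 0) :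
    ∃ φ : ℝ → ℝ, ContDiff ℝ ∞ φ ∧ HasCompactSupport φ ∧ tsupport φ ⊆ Set.Ioo 0 ℓ ∧
      deriv φ = ψ := by
  have hc := h1.continuous
  have hd : ∀ x, HasDerivAt (fun x => ∫ t in (0 : ℝ)..x, ψ t) (ψ x) x := fun x =>
    hc.integral_hasStrictDerivAt 0 x |>.hasDerivAt
  have hderiv : deriv (fun x => ∫ t in (0 : ℝ)..x, ψ t) = ψ := funext fun x => (hd x).deriv
  obtain ⟨c, d, hc0, hdℓ, hK⟩ := h2.isCompact.exists_subset_Icc_of_subset_Ioo hℓ h3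
  have hz : ∀ t, t ∉ Set.Icc c d → ψ t = 0 := fun t ht =>
    image_eq_zero_of_notMem_tsupport fun h => ht (hK h)
  have hzero : ∀ x y, (∀ t ∈ Set.uIcc x y, t ∉ Set.Icc c d) → ∫ t in x..y, ψ t = 0 := by
    intro x y hxy
    rw [intervalIntegral.integral_congr (g := fun _ => (0 : ℝ)) fun t ht => hz t (hxy t ht)]
    simp
  have hsupp : tsupport (fun x => ∫ t in (0 : ℝ)..x, ψ t) ⊆ Set.Icc c d := by
    refine closure_minimal (fun x hx => ?_) isClosed_Icc
    by_contra hx'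
    refine hx ?_
    rw [Set.mem_Icc, not_and_or, not_le, not_le] at hx'
    rcases hx' with hx' | hx'
    · exact hzero 0 x fun t ht ht' => by
        have := ht.2.trans_lt (max_lt hc0 hx')
        exact absurd ht'.1 (not_le.2 this)
    -- To the right of `d` the primitive already equals the total integral over `(0, ℓ)`, which is
    -- zero.
    · have e := intervalIntegral.integral_add_adjacent_intervals (hc.intervalIntegrable 0 x)
        (hc.intervalIntegrable (μ := volume) x ℓ)
      rw [← setIntegral_Ioo_eq_intervalIntegral (a := 0) (b := ℓ) hℓ.le, h4,
        hzero x ℓ fun t ht ht' => absurd ht'.2 (not_le.2 ((lt_min hx' hdℓ).trans_le ht.1)),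
        add_zero] at e
      exact e
  refine ⟨_, contDiff_infty_iff_deriv.2 ⟨fun x => (hd x).differentiableAt, by rw [hderiv]; exact h1⟩,
    HasCompactSupport.of_support_subset_isCompact isCompact_Icc
      ((subset_tsupport _).trans hsupp), hsupp.trans fun x hx => ⟨hc0.trans_le hx.1,
      hx.2.trans_lt hdℓ⟩, hderiv⟩

lemma Continuous.integrable_ofReal_mul {φ : ℝ → ℝ} (hφ : Continuous φ) (hc : HasCompactSupport φ)
    {μ : Measure ℝ} {u : ℝ → ℂ} (hu : Integrable u μ) :
    Integrable (fun x => (φ x : ℂ) * u x) μ := by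
  obtain ⟨C, hC⟩ := hc.exists_bound_of_continuous hφ
  refine hu.bdd_mul (c := C) (Complex.continuous_ofReal.comp hφ).aestronglyMeasurable
    (Filter.Eventually.of_forall fun x => ?_)
  simpa using hC x

/-- The du Bois-Reymond lemma: an integrable function with vanishing weak derivative is constant. -/
lemma exists_ae_eq_const_of_integral_deriv_mul_eq_zero {u : ℝ → ℂ} {ℓ : ℝ} (hℓ : 0 < ℓ)
    (hu : IntegrableOn u (Set.Ioo 0 ℓ))
    (h : ∀ φ : ℝ → ℝ, ContDiff ℝ ∞ φ → HasCompactSupport φ → tsupport φ ⊆ Set.Ioo 0 ℓ →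
      ∫ x in Set.Ioo 0 ℓ, ((deriv φ x : ℝ) : ℂ) * u x = 0) :
    ∃ c : ℂ, ∀ᵐ x ∂(volume.restrict (Set.Ioo 0 ℓ)), u x = c := by
  -- These radii keep the support of the bump in `[ℓ/4, 3ℓ/4]`. Since its normalisation `η` has
  -- integral one, the constant must be `∫ η u`.
  let b : ContDiffBump (ℓ / 2) := ⟨ℓ / 8, ℓ / 4, by linarith, by linarith⟩
  set η : ℝ → ℝ := b.normed volume with hη
  have η1 : ContDiff ℝ ∞ η := b.contDiff_normed
  have η2 : HasCompactSupport η := b.hasCompactSupport_normed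
  have η3 : tsupport η ⊆ Set.Ioo 0 ℓ := by
    rw [hη, b.tsupport_normed_eq, Real.closedBall_eq_Icc]
    intro x hx
    have e : b.rOut = ℓ / 4 := rfl
    rw [e] at hx
    exact ⟨by linarith [hx.1], by linarith [hx.2]⟩
  have full : ∀ ψ : ℝ → ℝ, tsupport ψ ⊆ Set.Ioo 0 ℓ → ∫ x in Set.Ioo 0 ℓ, ψ x = ∫ x, ψ x :=
    fun ψ hψ => setIntegral_eq_integral_of_forall_compl_eq_zero fun x hx =>
      image_eq_zero_of_notMem_tsupport fun hx' => hx (hψ hx')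
  have η4 : ∫ x in Set.Ioo 0 ℓ, η x = 1 := (full η η3).trans b.integral_normed
  set c : ℂ := ∫ x in Set.Ioo 0 ℓ, (η x : ℂ) * u x with hc
  refine ⟨c, ?_⟩
  have hconst : IntegrableOn (fun _ : ℝ => c) (Set.Ioo 0 ℓ) := by simp
  have key : ∀ᵐ x : ℝ, x ∈ Set.Ioo 0 ℓ → u x - c = 0 := by
    refine isOpen_Ioo.ae_eq_zero_of_integral_contDiff_smul_eq_zero
      (hu.sub hconst).locallyIntegrableOn fun ψ ψ1 ψ2 ψ3 => ?_
    rw [← setIntegral_eq_integral_of_forall_compl_eq_zero (s := Set.Ioo 0 ℓ) fun x hx => by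
      rw [image_eq_zero_of_notMem_tsupport fun hx' => hx (ψ3 hx'), zero_smul]]
    set k : ℝ := ∫ x in Set.Ioo 0 ℓ, ψ x with hk
    have iψ : IntegrableOn ψ (Set.Ioo 0 ℓ) :=
      (ψ1.continuous.integrable_of_hasCompactSupport ψ2).integrableOn
    have iη : IntegrableOn η (Set.Ioo 0 ℓ) :=
      (η1.continuous.integrable_of_hasCompactSupport η2).integrableOn
    -- Subtracting `k * η` gives `ψ` mean zero, so the hypothesis applies to the difference and
    -- yields `∫ ψ u = k * c = ∫ ψ c`.
    have s3 : tsupport (fun x => ψ x - k * η x) ⊆ Set.Ioo 0 ℓ := by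
      refine (tsupport_sub ψ (fun x => k * η x)).trans (Set.union_subset ψ3 ?_)
      exact (tsupport_mul_subset_right (f := fun _ => k) (g := η)).trans η3
    obtain ⟨φ, φ1, φ2, φ3, φ4⟩ := exists_deriv_eq_of_integral_eq_zero hℓ
      (ψ := fun x => ψ x - k * η x) (ψ1.sub (contDiff_const.mul η1)) (ψ2.sub η2.mul_left) s3 (by
        rw [integral_sub iψ (iη.const_mul k), integral_const_mul, η4, hk]
        ring)
    have e := h φ φ1 φ2 φ3
    have iψu := ψ1.continuous.integrable_ofReal_mul ψ2 hu
    have iηu := η1.continuous.integrable_ofReal_mul η2 hu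
    have iψc := ψ1.continuous.integrable_ofReal_mul ψ2 hconst
    rw [φ4] at e
    have e1 : ∫ x in Set.Ioo 0 ℓ, ((ψ x - k * η x : ℝ) : ℂ) * u x =
        (∫ x in Set.Ioo 0 ℓ, (ψ x : ℂ) * u x) - k * c := by
      rw [hc, ← integral_const_mul, ← integral_sub iψu (iηu.const_mul _)]
      exact integral_congr_ae (Filter.Eventually.of_forall fun x => by push_cast; ring)
    have e2 : ∫ x in Set.Ioo 0 ℓ, (ψ x : ℂ) * c = k * c := by
      rw [integral_mul_const, integral_complex_ofReal]
    have e3 : ∫ x in Set.Ioo 0 ℓ, ψ x • (u x - c) =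
        (∫ x in Set.Ioo 0 ℓ, (ψ x : ℂ) * u x) - ∫ x in Set.Ioo 0 ℓ, (ψ x : ℂ) * c := by
      rw [← integral_sub iψu iψc]
      exact integral_congr_ae (Filter.Eventually.of_forall fun x => by
        simp only [Complex.real_smul]; ring)
    rw [e3, e2, ← e1, e]
  rw [ae_restrict_iff' measurableSet_Ioo]
  filter_upwards [key] with x hx hx'
  exact sub_eq_zero.1 (hx hx')

/-! ### Continuous representatives and traces on an edge -/

namespace QGraph

lemma L2Interval.intervalIntegrable {ℓ : ℝ} (hℓ : 0 ≤ ℓ) (f : L2Interval ℓ) :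
    IntervalIntegrable f volume 0 ℓ := by
  rw [intervalIntegrable_iff_integrableOn_Ioo_of_le hℓ]
  exact (Lp.memLp f).integrable one_le_two

/-- A function with a weak derivative is a primitive of it. -/
lemma HasWeakDeriv.exists_ae_eq {ℓ : ℝ} (hℓ : 0 < ℓ) {f g : L2Interval ℓ}
    (h : HasWeakDeriv f g) :
    ∃ c : ℂ, f =ᵐ[volume.restrict (Set.Ioo 0 ℓ)] fun x => c + ∫ t in (0 : ℝ)..x, g t := by
  have ig := L2Interval.intervalIntegrable hℓ.le g
  have hf : IntegrableOn f (Set.Ioo 0 ℓ) := (Lp.memLp f).integrable one_le_two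
  have hgc : ContinuousOn (fun x => ∫ t in (0 : ℝ)..x, g t) (Set.Icc 0 ℓ) := by
    have := intervalIntegral.continuousOn_primitive_interval' (μ := volume) ig Set.left_mem_uIcc
    rwa [Set.uIcc_of_le hℓ.le] at this
  have hG : IntegrableOn (fun x => ∫ t in (0 : ℝ)..x, g t) (Set.Ioo 0 ℓ) :=
    (hgc.integrableOn_compact isCompact_Icc).mono_set Set.Ioo_subset_Icc_self
  obtain ⟨c, hc⟩ := exists_ae_eq_const_of_integral_deriv_mul_eq_zero hℓ (hf.sub hG)
    fun φ φ1 φ2 φ3 => by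
      have hd : Continuous (deriv φ) := φ1.continuous_deriv (by simp)
      have z : ∀ x, x ∉ Set.Ioo 0 ℓ → φ x = 0 := fun x hx =>
        image_eq_zero_of_notMem_tsupport fun hx' => hx (φ3 hx')
      have e1 : ∫ x in Set.Ioo 0 ℓ, ((deriv φ x : ℝ) : ℂ) * (f - fun x => ∫ t in (0 : ℝ)..x, g t) x
          = (∫ x in Set.Ioo 0 ℓ, ((deriv φ x : ℝ) : ℂ) * f x) -
            ∫ x in Set.Ioo 0 ℓ, ((deriv φ x : ℝ) : ℂ) * ∫ t in (0 : ℝ)..x, g t := by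
        rw [← integral_sub (hd.integrable_ofReal_mul φ2.deriv hf)
          (hd.integrable_ofReal_mul φ2.deriv hG)]
        exact integral_congr_ae (Filter.Eventually.of_forall fun x => by
          simp only [Pi.sub_apply]; ring)
      have dφ : ∀ x, HasDerivAt (fun x => (φ x : ℂ)) ((deriv φ x : ℝ) : ℂ) x := fun x =>
        ((φ1.differentiable (by simp)).differentiableAt.hasDerivAt).ofReal_comp
      have cφ : Continuous fun x => ((deriv φ x : ℝ) : ℂ) := Complex.continuous_ofReal.comp hd
      -- Integration by parts against `φ`, whose boundary terms vanish, shows that the primitive of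
      -- `g` also has weak derivative `g`; hence `f` minus it has weak derivative zero.
      have e2 := intervalIntegral_mul_add_mul_of_primitive
        (p := fun x => ((deriv φ x : ℝ) : ℂ)) (F := fun x => (φ x : ℂ)) (q := g)
        (G := fun x => ∫ t in (0 : ℝ)..x, g t) (cφ.intervalIntegrable 0 ℓ) ig
        (fun x _ => by
          rw [intervalIntegral.integral_eq_sub_of_hasDerivAt (fun t _ => dφ t)
            (cφ.intervalIntegrable 0 x)]
          ring)
        (fun x _ => by simp)
      have e3 := h φ φ1 φ2 φ3
      have i1 := hd.integrable_ofReal_mul φ2.deriv hG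
      have i2 := φ1.continuous.integrable_ofReal_mul φ2
        (u := g) (μ := volume.restrict (Set.Ioo 0 ℓ)) ((Lp.memLp g).integrable one_le_two)
      rw [← setIntegral_Ioo_eq_intervalIntegral hℓ.le, integral_add i1 i2, z ℓ (by simp),
        z 0 (by simp)] at e2
      rw [e1, e3]
      simp only [Complex.ofReal_zero, zero_mul, sub_zero] at e2
      linear_combination -e2
  refine ⟨c, ?_⟩
  filter_upwards [hc] with x hx
  simp only [Pi.sub_apply] at hx
  rw [← hx]
  ring

/-- Traces are computed by any representative that is continuous on the closed interval. -/
lemma HasTrace.eq {ℓ : ℝ} (hℓ : 0 < ℓ) {f : L2Interval ℓ} {F : ℝ → ℂ} {x : ℝ} {c : ℂ}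
    (h : HasTrace f x c) (hF : ContinuousOn F (Set.Icc 0 ℓ))
    (hf : f =ᵐ[volume.restrict (Set.Ioo 0 ℓ)] F) (hx : x ∈ Set.Icc 0 ℓ) : c = F x := by
  obtain ⟨H, h1, h2, rfl⟩ := h
  refine Measure.eqOn_Icc_of_ae_eq (μ := volume) hℓ.ne ?_ h1 hF hx
  rw [← Measure.restrict_congr_set Ioo_ae_eq_Icc]
  exact h2.symm.trans hf

/-- An eigenfunction on an edge is represented by a solution of the eigenvalue equation. -/
lemma exists_isSolution {ℓ : ℝ} (hℓ : 0 < ℓ) {f f' f'' : L2Interval ℓ} {W : ℝ → ℝ} {μ : ℂ}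
    (h : HasWeakDeriv f f') (h' : HasWeakDeriv f' f'')
    (heq : ∀ᵐ x ∂(volume.restrict (Set.Ioo 0 ℓ)), μ * f x = -(f'' x) + (W x : ℂ) * f x) :
    ∃ F P : ℝ → ℂ, IsSolution (fun x => W x - μ) ℓ F P ∧
      f =ᵐ[volume.restrict (Set.Ioo 0 ℓ)] F ∧ f' =ᵐ[volume.restrict (Set.Ioo 0 ℓ)] P := by
  obtain ⟨c, hc⟩ := h.exists_ae_eq hℓ
  obtain ⟨d, hd⟩ := h'.exists_ae_eq hℓ
  have prim : ∀ (k : ℂ) (g : L2Interval ℓ),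
      ContinuousOn (fun x => k + ∫ t in (0 : ℝ)..x, g t) (Set.Icc 0 ℓ) := fun k g => by
    have := intervalIntegral.continuousOn_primitive_interval' (μ := volume)
      (L2Interval.intervalIntegrable hℓ.le g) Set.left_mem_uIcc
    rw [Set.uIcc_of_le hℓ.le] at this
    exact continuousOn_const.add this
  have congr : ∀ {u v : ℝ → ℂ}, u =ᵐ[volume.restrict (Set.Ioo 0 ℓ)] v → ∀ x ∈ Set.Icc 0 ℓ,
      ∫ t in (0 : ℝ)..x, u t = ∫ t in (0 : ℝ)..x, v t := fun {u v} huv x hx => by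
    rw [← setIntegral_Ioo_eq_intervalIntegral hx.1, ← setIntegral_Ioo_eq_intervalIntegral hx.1]
    exact integral_congr_ae (ae_restrict_of_ae_restrict_of_subset
      (Set.Ioo_subset_Ioo_right hx.2) huv)
  refine ⟨_, _, ⟨prim c f', prim d f'', fun x hx => ?_, fun x hx => ?_⟩, hc, hd⟩
  · rw [congr hd x hx]
    simp
  · rw [congr (v := fun t => (W t - μ) * (c + ∫ s in (0 : ℝ)..t, f' s)) ?_ x hx]
    · simp
    · filter_upwards [heq, hc] with t h1 h2
      rw [← h2]
      linear_combination h1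

end QGraph

/-! ### Incidence and flows on the tree -/

namespace QGraph

namespace QuantumGraph

section

variable {V : Type*} {G : SimpleGraph V}

lemma adj (T : QuantumGraph G) (e : G.edgeSet) : G.Adj (T.src e) (T.tgt e) := by
  rw [← SimpleGraph.mem_edgeSet, T.ends e]
  exact e.2

/-- The orientation of an edge is arbitrary, so incidence is stated symmetrically in the two ends.
-/
lemma exists_edge_of_adj (T : QuantumGraph G) {u v : V} (h : G.Adj u v) :
    ∃ e, (T.src e = u ∨ T.tgt e = u) ∧ (T.src e = v ∨ T.tgt e = v) := by
  have he := T.ends ⟨s(u, v), h⟩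
  refine ⟨⟨s(u, v), h⟩, ?_⟩
  rcases Sym2.eq_iff.1 he with ⟨h1, h2⟩ | ⟨h1, h2⟩
  · exact ⟨Or.inl h1, Or.inr h2⟩
  · exact ⟨Or.inr h2, Or.inl h1⟩

lemma zero_mem_Icc (T : QuantumGraph G) (e : G.edgeSet) : (0 : ℝ) ∈ Set.Icc 0 (T.length e) :=
  ⟨le_rfl, (T.length_pos e).le⟩

lemma length_mem_Icc (T : QuantumGraph G) (e : G.edgeSet) :
    T.length e ∈ Set.Icc 0 (T.length e) :=
  ⟨(T.length_pos e).le, le_rfl⟩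

lemma intervalIntegrable_potential (T : QuantumGraph G) (μ : ℂ) (e : G.edgeSet) :
    IntervalIntegrable (fun x => (T.potential e x : ℂ) - μ) volume 0 (T.length e) := by
  have h : IntegrableOn (fun x => (T.potential e x : ℂ)) (Set.Ioo 0 (T.length e)) :=
    ((T.potential_memLp e).integrable one_le_two).ofReal
  exact ((intervalIntegrable_iff_integrableOn_Ioo_of_le (T.length_pos e).le).2 h).sub
    intervalIntegrable_const

end

variable {V : Type*} [Fintype V] [DecidableEq V] {G : SimpleGraph V} [DecidableRel G.Adj]

lemma mem_incidenceFinset (T : QuantumGraph G) {e : G.edgeSet} {v : V}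
    (h : T.src e = v ∨ T.tgt e = v) : (e : Sym2 V) ∈ G.incidenceFinset v := by
  rw [SimpleGraph.mem_incidenceFinset]
  refine ⟨e.2, ?_⟩
  rw [← T.ends e, Sym2.mem_iff]
  exact h.imp Eq.symm Eq.symm

/-- This ensures that passing from one edge to a different one always goes through an internal
vertex, where the given eigenfunction is non-zero. -/
lemma isInternal_of_ne (T : QuantumGraph G) {e e' : G.edgeSet} {v : V} (hne : e ≠ e')
    (h : T.src e = v ∨ T.tgt e = v) (h' : T.src e' = v ∨ T.tgt e' = v) : T.IsInternal v := by
  rw [IsInternal, ← G.card_incidenceFinset_eq_degree v]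
  exact Finset.one_lt_card.2 ⟨e, T.mem_incidenceFinset h, e', T.mem_incidenceFinset h',
    fun h => hne (Subtype.ext h)⟩

/-- A flow on the edges of an acyclic graph that is conserved at every vertex vanishes. -/
lemma flow_eq_zero (T : QuantumGraph G) (hG : G.IsAcyclic) (W : G.edgeSet → ℂ)
    (hW : ∀ v, ∑ e with T.src e = v, W e - ∑ e with T.tgt e = v, W e = 0) (e : G.edgeSet) :
    W e = 0 := by
  classical
  have hbr : ¬ (G.deleteEdges {(e : Sym2 V)}).Reachable (T.src e) (T.tgt e) := by
    have := SimpleGraph.isAcyclic_iff_forall_isBridge.1 hG e.2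
    rw [← T.ends e] at this ⊢
    exact SimpleGraph.isBridge_iff.1 this
  set S : Finset V :=
    -- `S` is the component of `T.src e` after the bridge `e` is removed.
    Finset.univ.filter fun v => (G.deleteEdges {(e : Sym2 V)}).Reachable (T.src e) v with hS
  have hsum : ∑ v ∈ S, (∑ e with T.src e = v, W e - ∑ e with T.tgt e = v, W e) = 0 :=
    Finset.sum_eq_zero fun v _ => hW v
  have hfib : ∀ t : G.edgeSet → V, ∑ v ∈ S, ∑ e with t e = v, W e =
      ∑ e, if t e ∈ S then W e else 0 := by
    intro t
    simp only [Finset.sum_filter]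
    rw [Finset.sum_comm]
    exact Finset.sum_congr rfl fun i _ => by rw [Finset.sum_ite_eq]
  -- In the conservation law summed over `S`, an edge other than `e` has both ends in `S` or neither
  -- and cancels; only `W e` is left.
  rw [Finset.sum_sub_distrib, hfib, hfib, ← Finset.sum_sub_distrib,
    Finset.sum_eq_single e] at hsum
  · have m1 : T.src e ∈ S := by simp [hS]
    have m2 : T.tgt e ∉ S := by simpa [hS] using hbr
    simpa [m1, m2] using hsum
  · intro i _ hi
    have hadj : (G.deleteEdges {(e : Sym2 V)}).Adj (T.src i) (T.tgt i) := by
      rw [SimpleGraph.deleteEdges_adj, T.ends i]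
      exact ⟨T.adj i, fun h => hi (Subtype.ext h)⟩
    have hiff : T.src i ∈ S ↔ T.tgt i ∈ S := by
      simp only [hS, Finset.mem_filter, Finset.mem_univ, true_and]
      exact ⟨fun h => h.trans hadj.reachable, fun h => h.trans hadj.symm.reachable⟩
    simp [hiff]
  · simp

/-! ### Wronskians and propagation of zeros -/

/-- `u`, `u'` and `c` are the edge functions, their derivatives and the vertex values of a
solution of the eigenvalue equation that satisfies the vertex conditions. -/
structure IsEigenData (T : QuantumGraph G) (μ : ℂ) (u u' : G.edgeSet → ℝ → ℂ) (c : V → ℂ) :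
    Prop where
  sol : ∀ e, IsSolution (fun x => T.potential e x - μ) (T.length e) (u e) (u' e)
  src : ∀ e, u e 0 = c (T.src e)
  tgt : ∀ e, u e (T.length e) = c (T.tgt e)
  dirichlet : ∀ v, T.coupling v = ⊤ → c v = 0
  flux : ∀ v, ∀ α : ℝ, T.coupling v = (α : WithTop ℝ) →
    ∑ e with T.src e = v, u' e 0 - ∑ e with T.tgt e = v, u' e (T.length e) = α * c v

namespace IsEigenData

variable {T : QuantumGraph G} {μ k : ℂ} {u u' w w' : G.edgeSet → ℝ → ℂ} {c d : V → ℂ}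

lemma sub_smul (hw : T.IsEigenData μ w w' d) (hu : T.IsEigenData μ u u' c) (k : ℂ) :
    T.IsEigenData μ (fun e x => w e x - k * u e x) (fun e x => w' e x - k * u' e x)
      (fun v => d v - k * c v) where
  sol e := (hw.sol e).sub_smul (hu.sol e) (T.intervalIntegrable_potential μ e) k
  src e := by rw [hw.src, hu.src]
  tgt e := by rw [hw.tgt, hu.tgt]
  dirichlet v hv := by rw [hw.dirichlet v hv, hu.dirichlet v hv]; simp
  flux v α hα := by
    simp only [Finset.sum_sub_distrib, ← Finset.mul_sum]
    linear_combination hw.flux v α hα - k * hu.flux v α hα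

/-- On a tree, the Wronskian of two eigenfunctions vanishes. -/
lemma wronskian_eq_zero (hG : G.IsAcyclic) (hu : T.IsEigenData μ u u' c)
    (hw : T.IsEigenData μ w w' d) (e : G.edgeSet) {x : ℝ} (hx : x ∈ Set.Icc 0 (T.length e)) :
    u e x * w' e x - u' e x * w e x = 0 := by
  have hconst := fun e => (hu.sol e).wronskian (hw.sol e) (T.intervalIntegrable_potential μ e)
    (T.length_mem_Icc e)
  rw [(hu.sol e).wronskian (hw.sol e) (T.intervalIntegrable_potential μ e) hx]
  refine T.flow_eq_zero hG (fun e => u e 0 * w' e 0 - u' e 0 * w e 0) (fun v => ?_) e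
  have e1 : ∑ e with T.src e = v, (u e 0 * w' e 0 - u' e 0 * w e 0) =
      c v * ∑ e with T.src e = v, w' e 0 - d v * ∑ e with T.src e = v, u' e 0 := by
    rw [Finset.mul_sum, Finset.mul_sum, ← Finset.sum_sub_distrib]
    refine Finset.sum_congr rfl fun i hi => ?_
    rw [hu.src, hw.src, (Finset.mem_filter.1 hi).2]
    ring
  have e2 : ∑ e with T.tgt e = v, (u e 0 * w' e 0 - u' e 0 * w e 0) =
      c v * ∑ e with T.tgt e = v, w' e (T.length e) -
        d v * ∑ e with T.tgt e = v, u' e (T.length e) := by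
    rw [Finset.mul_sum, Finset.mul_sum, ← Finset.sum_sub_distrib]
    refine Finset.sum_congr rfl fun i hi => ?_
    -- At a target vertex the constant Wronskian is read off at the far end of the edge.
    rw [← hconst, hu.tgt, hw.tgt, (Finset.mem_filter.1 hi).2]
    ring
  rw [e1, e2]
  -- At a Dirichlet vertex both values vanish; otherwise both fluxes are `α` times the values, and
  -- `c v * (α * d v) - d v * (α * c v)` is zero.
  rcases h : T.coupling v with _ | α
  · rw [hu.dirichlet v h, hw.dirichlet v h]
    ring
  · linear_combination c v * hw.flux v α h - d v * hu.flux v α h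

/-- If an eigenfunction vanishes on one edge of a tree, and another one does not vanish at internal
vertices, then the former vanishes. -/
lemma eq_zero (hG : G.IsTree) (hu : T.IsEigenData μ u u' c) (hw : T.IsEigenData μ w w' d)
    (hc : ∀ v, T.IsInternal v → c v ≠ 0) {e₀ : G.edgeSet}
    (h0 : ∀ x ∈ Set.Icc 0 (T.length e₀), w e₀ x = 0) (e : G.edgeSet) :
    ∀ x ∈ Set.Icc 0 (T.length e), w e x = 0 := by
  have ez : ∀ e, ∀ x ∈ Set.Icc 0 (T.length e), w e x = 0 → w' e x = 0 →
      ∀ y ∈ Set.Icc 0 (T.length e), w e y = 0 ∧ w' e y = 0 := fun e x hx h h' =>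
    (hw.sol e).eq_zero (T.intervalIntegrable_potential μ e) hx h h'
  have step : ∀ e e' v, (T.src e = v ∨ T.tgt e = v) → (T.src e' = v ∨ T.tgt e' = v) →
      (∀ x ∈ Set.Icc 0 (T.length e), w e x = 0) → ∀ x ∈ Set.Icc 0 (T.length e'), w e' x = 0 := by
    intro e e' v he he' hz
    rcases eq_or_ne e e' with rfl | hne
    · exact hz
    have hcv := hc v (T.isInternal_of_ne hne he he')
    have hdv : d v = 0 := by
      rcases he with rfl | rfl
      · rw [← hw.src, hz _ (T.zero_mem_Icc e)]
      · rw [← hw.tgt, hz _ (T.length_mem_Icc e)]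
    obtain ⟨y, hy, huy, hwy⟩ : ∃ y ∈ Set.Icc 0 (T.length e'), u e' y = c v ∧ w e' y = d v := by
      rcases he' with rfl | rfl
      · exact ⟨0, T.zero_mem_Icc e', hu.src e', hw.src e'⟩
      · exact ⟨_, T.length_mem_Icc e', hu.tgt e', hw.tgt e'⟩
    -- With `d v = 0` the Wronskian at `v` reduces to `c v * w' e' y`, so both Cauchy data of `w` on
    -- `e'` vanish there.
    have hW := hu.wronskian_eq_zero hG.isAcyclic hw e' hy
    rw [huy, hwy, hdv, mul_zero, sub_zero] at hW
    exact fun x hx =>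
      (ez e' y hy (hwy.trans hdv) ((mul_eq_zero.1 hW).resolve_left hcv) x hx).1
  have hall : ∀ v, ∀ e, (T.src e = v ∨ T.tgt e = v) →
      ∀ x ∈ Set.Icc 0 (T.length e), w e x = 0 := by
    intro v
    have hr : Relation.ReflTransGen G.Adj (T.src e₀) v :=
      (SimpleGraph.reachable_iff_reflTransGen _ _).1 (hG.connected (T.src e₀) v)
    induction hr with
    | refl => exact fun e he => step e₀ e _ (Or.inl rfl) he h0
    | tail _ hadj ih =>
      obtain ⟨e₁, h1, h2⟩ := T.exists_edge_of_adj hadj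
      exact fun e he => step e₁ e _ h2 he (ih e₁ h1)
  exact hall _ e (Or.inl rfl)

end IsEigenData

/-! ### From the eigenspace to edge solutions and back -/

/-- Every eigenfunction has continuously differentiable edge representatives. -/
lemma exists_isEigenData {T : QuantumGraph G} {μ : ℂ} {f : T.L2} (hf : f ∈ T.eigenspace μ) :
    ∃ u u' c, T.IsEigenData μ u u' c ∧ (∀ v, T.HasValue f v (c v)) ∧
      ∀ e, f e =ᵐ[volume.restrict (Set.Ioo 0 (T.length e))] u e := by
  obtain ⟨f', f'', h1, h2, h3, h4⟩ := hf
  have hex : ∀ e, ∃ F P : ℝ → ℂ, IsSolution (fun x => T.potential e x - μ) (T.length e) F P ∧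
      f e =ᵐ[volume.restrict (Set.Ioo 0 (T.length e))] F ∧
      f' e =ᵐ[volume.restrict (Set.Ioo 0 (T.length e))] P := fun e => by
    refine exists_isSolution (T.length_pos e) (h1 e) (h2 e) ?_
    filter_upwards [h4 e, Lp.coeFn_smul μ (f e)] with x e1 e2
    rw [← e1, PiLp.smul_apply, e2, Pi.smul_apply, smul_eq_mul]
  choose u u' hsol hu hu' using hex
  choose c hval hdir hflux using h3
  refine ⟨u, u', c, ⟨hsol, fun e => ?_, fun e => ?_, hdir, fun v α hα => ?_⟩, hval, hu⟩
  · exact (((hval _ e).1 rfl).eq (T.length_pos e) (hsol e).cont (hu e) (T.zero_mem_Icc e)).symm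
  · exact (((hval _ e).2 rfl).eq (T.length_pos e) (hsol e).cont (hu e) (T.length_mem_Icc e)).symm
  · obtain ⟨a, b, ha, hb, hs⟩ := hflux v α hα
    rw [hs]
    congr 1
    · exact Finset.sum_congr rfl fun e _ =>
        ((ha e).eq (T.length_pos e) (hsol e).cont' (hu' e) (T.zero_mem_Icc e)).symm
    · exact Finset.sum_congr rfl fun e _ =>
        ((hb e).eq (T.length_pos e) (hsol e).cont' (hu' e) (T.length_mem_Icc e)).symm

/-- Values at internal vertices are unique. -/
lemma HasValue.unique {T : QuantumGraph G} {f : T.L2} {v : V} {a b : ℂ} (hv : T.IsInternal v)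
    (ha : T.HasValue f v a) (hb : T.HasValue f v b) : a = b := by
  obtain ⟨w, hw⟩ := (G.degree_pos_iff_exists_adj v).1 (two_pos.trans_le hv)
  obtain ⟨e, he, -⟩ := T.exists_edge_of_adj hw
  rcases he with he | he
  · have h := (hb e).1 he
    obtain ⟨F, hF, hfF, rfl⟩ := h
    exact ((ha e).1 he).eq (T.length_pos e) hF hfF (T.zero_mem_Icc e)
  · have h := (hb e).2 he
    obtain ⟨F, hF, hfF, rfl⟩ := h
    exact ((ha e).2 he).eq (T.length_pos e) hF hfF (T.length_mem_Icc e)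

/-- On a tree, every eigenfunction is a multiple of an eigenfunction that does not vanish at
internal vertices. -/
lemma exists_eq_smul {T : QuantumGraph G} (hG : G.IsTree) {μ : ℂ} {f g : T.L2}
    (hf : f ∈ T.eigenspace μ) (hg : g ∈ T.eigenspace μ) (hf0 : f ≠ 0)
    (hint : ∀ v, T.IsInternal v → ∃ c : ℂ, c ≠ 0 ∧ T.HasValue f v c) : ∃ k : ℂ, k • f = g := by
  obtain ⟨u, u', c, hu, hval, hfu⟩ := exists_isEigenData hf
  obtain ⟨w, w', d, hw, -, hgw⟩ := exists_isEigenData hg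
  have hc : ∀ v, T.IsInternal v → c v ≠ 0 := fun v hv => by
    obtain ⟨a, ha, hfa⟩ := hint v hv
    rwa [(hval v).unique hv hfa]
  obtain ⟨e₀, he₀⟩ : ∃ e, f e ≠ 0 := by
    by_contra! h
    exact hf0 (PiLp.ext h)
  have hne : ¬ (u e₀ 0 = 0 ∧ u' e₀ 0 = 0) := fun h => he₀ <| by
    refine (Lp.eq_zero_iff_ae_eq_zero).2 ?_
    filter_upwards [hfu e₀, ae_restrict_mem measurableSet_Ioo] with x hx hxI
    rw [hx]
    exact ((hu.sol e₀).eq_zero (T.intervalIntegrable_potential μ e₀) (T.zero_mem_Icc e₀) h.1 h.2 x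
      (Set.Ioo_subset_Icc_self hxI)).1
  have hW := hu.wronskian_eq_zero hG.isAcyclic hw e₀ (T.zero_mem_Icc e₀)
  -- The Cauchy data of `u` at `0` are non-zero, and the zero Wronskian makes those of `w`
  -- proportional to them; `k` is the ratio of whichever component is non-zero for `u`.
  obtain ⟨k, hk, hk'⟩ : ∃ k, w e₀ 0 - k * u e₀ 0 = 0 ∧ w' e₀ 0 - k * u' e₀ 0 = 0 := by
    by_cases h : u e₀ 0 = 0
    · have h' : u' e₀ 0 ≠ 0 := fun h' => hne ⟨h, h'⟩
      refine ⟨w' e₀ 0 / u' e₀ 0, ?_, by field_simp; ring⟩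
      rw [h, zero_mul, zero_sub, neg_eq_zero] at hW
      rw [h, (mul_eq_zero.1 hW).resolve_left h']
      ring
    · refine ⟨w e₀ 0 / u e₀ 0, by field_simp; ring, ?_⟩
      field_simp
      linear_combination hW
  have hh := hw.sub_smul hu k
  have hz := hu.eq_zero hG hh hc (e₀ := e₀)
    (fun x hx => ((hh.sol e₀).eq_zero (T.intervalIntegrable_potential μ e₀) (T.zero_mem_Icc e₀)
      hk hk' x hx).1)
  refine ⟨k, PiLp.ext fun e => Lp.ext ?_⟩
  rw [PiLp.smul_apply]
  filter_upwards [Lp.coeFn_smul k (f e), hfu e, hgw e, ae_restrict_mem measurableSet_Ioo]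
    with x e1 e2 e3 hx
  rw [e1, Pi.smul_apply, e2, e3, smul_eq_mul]
  exact (sub_eq_zero.1 (hz e x (Set.Ioo_subset_Icc_self hx))).symm

/-- The eigenfunctions that vanish at a vertex. -/
def vanishingSubmodule (T : QuantumGraph G) (μ : ℂ) (v : V) : Submodule ℂ (T.eigenspace μ) where
  carrier := {f | T.HasValue (f : T.L2) v 0}
  zero_mem' := fun _ => ⟨fun _ => HasTrace.zero, fun _ => HasTrace.zero⟩
  add_mem' := fun hf hg e =>
    ⟨fun he => by simpa using HasTrace.linear 1 1 ((hf e).1 he) ((hg e).1 he),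
      fun he => by simpa using HasTrace.linear 1 1 ((hf e).2 he) ((hg e).2 he)⟩
  smul_mem' := fun k _ hf e =>
    ⟨fun he => by simpa using HasTrace.linear k 0 ((hf e).1 he) HasTrace.zero,
      fun he => by simpa using HasTrace.linear k 0 ((hf e).2 he) HasTrace.zero⟩

lemma rank_eigenspace_eq_one {T : QuantumGraph G} (hG : G.IsTree) {μ : ℂ} {f : T.L2}
    (hf : f ∈ T.eigenspace μ) (hf0 : f ≠ 0)
    (hint : ∀ v, T.IsInternal v → ∃ c : ℂ, c ≠ 0 ∧ T.HasValue f v c) :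
    Module.rank ℂ (T.eigenspace μ) = 1 := by
  refine rank_eq_one_iff.2 ⟨⟨f, hf⟩, fun h => hf0 (congrArg Subtype.val h), fun g => ?_⟩
  obtain ⟨k, hk⟩ := exists_eq_smul hG hf g.2 hf0 hint
  exact ⟨k, Subtype.ext hk⟩

end QuantumGraph

end QGraph

/-! ### The two claims -/

theorem corollary5p2 {V : Type*} [Fintype V] [DecidableEq V] {G : SimpleGraph V}
    [DecidableRel G.Adj] (hG : G.IsTree) (T : QGraph.QuantumGraph G)
    (hT : ∀ v, T.IsInternal v → T.coupling v ≠ ⊤) (μ : ℂ) :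
    ((∃ f ∈ T.eigenspace μ, f ≠ 0 ∧ ∀ v, T.IsInternal v → ∃ c : ℂ, c ≠ 0 ∧ T.HasValue f v c) →
      Module.rank ℂ (T.eigenspace μ) = 1) ∧
    (1 < Module.rank ℂ (T.eigenspace μ) →
      ∃ v, T.IsInternal v ∧ ∀ f ∈ T.eigenspace μ, T.HasValue f v 0) := by
  refine ⟨fun ⟨f, hf, hf0, hint⟩ => QGraph.QuantumGraph.rank_eigenspace_eq_one hG hf hf0 hint,
    fun hrank => ?_⟩
  by_contra! hno
  have hnt : Nontrivial (T.eigenspace μ) := rank_pos_iff_nontrivial.1 (zero_lt_one.trans hrank)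
  -- The index `none` carries the zero subspace, so a vector avoiding every `p o` is non-zero and
  -- also fails to vanish at each internal vertex. Such a vector exists because all these finitely
  -- many subspaces are proper; the first part then contradicts `hrank`.
  let p : Option {v // T.IsInternal v} → Submodule ℂ (T.eigenspace μ) := fun o =>
    o.elim ⊥ fun v => T.vanishingSubmodule μ v
  obtain ⟨x, hx⟩ := Submodule.exists_forall_notMem_of_forall_ne_top p (by
    rintro (_ | ⟨v, hv⟩)
    · exact bot_ne_top
    · intro htop
      obtain ⟨f, hf, hfv⟩ := hno v hv
      have hmem : (⟨f, hf⟩ : T.eigenspace μ) ∈ T.vanishingSubmodule μ v :=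
        (Submodule.eq_top_iff'.1 htop) _
      exact hfv hmem)
  refine hrank.ne' (QGraph.QuantumGraph.rank_eigenspace_eq_one hG x.2
    (fun h => hx none (Subtype.ext h)) fun v hv => ?_)
  obtain ⟨-, -, c, -, hval, -⟩ := QGraph.QuantumGraph.exists_isEigenData x.2
  refine ⟨c v, fun h => hx (some ⟨v, hv⟩) ?_, hval v⟩
  change T.HasValue (x : T.L2) v 0
  rw [← h]
  exact hval v
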